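/- Let $n, m_1, m_2$ be nonnegative integers. A partition of $n$ is a finite list of integers $\lambda_1 \ge \lambda_2 \ge \cdots \ge \lambda_k \ge 1$ with sum $n$; its parts are the $\lambda_i$, counted with multiplicity, and adjacent parts are consecutive entries $\lambda_i, \lambda_{i+1}$. Let $C_1(m_1,m_2,n)$ be the number of partitions of $n$ into parts congruent to $0$, $1$, $3$, or $5 \pmod 6$ in which exactly $m_1$ parts are congruent to $1 \pmod 6$ and exactly $m_2$ parts are congruent to $5 \pmod 6$. Let $C_2(m_1,m_2,n)$ be the number of partitions of $n$ that satisfy the following conditions: - if two adjacent parts differ by exactly $1$, then the smaller part is not $\equiv 1 \pmod 3$; - if two adjacent parts differ by exactly $2$, then the smaller part is $\equiv 2 \pmod 3$; - no part is equal to $2$; - exactly $m_1$ parts are congruent to $1 \pmod 3$ and exactly $m_2$ parts are congruent to $2 \pmod 3$. Then $C_1(m_1,m_2,n) = C_2(m_1,m_2,n)$. -/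

import Mathlib

/-- The number of parts of the partition `p`, counted with multiplicity, that are congruent to
`i` modulo `m`. -/
def numPartsModEq {n : ℕ} (p : n.Partition) (i m : ℕ) : ℕ :=
  p.parts.countP (fun x => x ≡ i [MOD m])

/-- `a` and `b` are adjacent parts of `p` (with `a` before `b`): they are consecutive entries of
the list of all parts of `p`, with repetitions, in weakly decreasing order. -/
def AdjacentParts {n : ℕ} (p : n.Partition) (a b : ℕ) : Prop :=
  [a, b] <:+: p.parts.sort (· ≥ ·)

/-- The number of partitions of `n` into parts congruent to `0`, `1`, `3` or `5` modulo `6`, with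
exactly `m₁` parts congruent to `1` modulo `6` and `m₂` parts congruent to `5` modulo `6`. -/
noncomputable def C₁ (m₁ m₂ n : ℕ) : ℕ :=
  Nat.card {p : n.Partition //
    (∀ x ∈ p.parts, x ≡ 0 [MOD 6] ∨ x ≡ 1 [MOD 6] ∨ x ≡ 3 [MOD 6] ∨ x ≡ 5 [MOD 6]) ∧
    numPartsModEq p 1 6 = m₁ ∧ numPartsModEq p 5 6 = m₂}

/-- The difference conditions on a partition: of two adjacent parts that differ by exactly `1` the
smaller one is not `1` modulo `3`, of two adjacent parts that differ by exactly `2` the smaller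
one is `2` modulo `3`, and no part equals `2`. -/
structure DifferenceConditions {n : ℕ} (p : n.Partition) : Prop where
  diff_one : ∀ a b, AdjacentParts p a b → a = b + 1 → ¬ b ≡ 1 [MOD 3]
  diff_two : ∀ a b, AdjacentParts p a b → a = b + 2 → b ≡ 2 [MOD 3]
  no_two : 2 ∉ p.parts

/-- The number of partitions of `n` satisfying the difference conditions, with exactly `m₁` parts
congruent to `1` modulo `3` and `m₂` parts congruent to `2` modulo `3`. -/
noncomputable def C₂ (m₁ m₂ n : ℕ) : ℕ :=
  Nat.card {p : n.Partition //
    DifferenceConditions p ∧ numPartsModEq p 1 3 = m₁ ∧ numPartsModEq p 2 3 = m₂}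

/-! Both difference conditions see only the set of parts, so the second family is enumerated by a
sum over admissible supports `S` of products of `w q^i / (1 - w q^i)`, where `w` is `x`, `y` or `1`
according to the residue of `i` mod 3. Cut the supports into levels `{3K, 3K+1, 3K+2}` and put `Q =
q^3`, writing `x`, `y` for `x q`, `y q^2`. A two-state transfer (does the next level contain its
multiple of 3?), cleared of denominators and with one state eliminated, gives the three-term
`LevelRecurrence`. The key is the contiguity `LevelRecurrence.shift`: a solution for `y` yields one
for `y Q^2`, and at level 0 this only costs a factor `1 - y`. Iterating until `y` vanishes leaves a
two-term recurrence, so the normalised sum is `∏ (1 - y Q^(2k)) (1 - x Q^(2k+1))`. Dividing by the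
denominators leaves `1 / ∏ (1 - Q^k) (1 - x Q^(2k)) (1 - y Q^(2k+1))`, whose factors are exactly the
parts 0, 3, 1 and 5 mod 6. Working modulo `q^(n+1)` makes `Q` nilpotent and every product finite. -/

/-! ### The three-term recurrence and its contiguity relation. -/

section Recurrence

variable {R : Type*} [CommRing R]

/-- The three-term recurrence satisfied by the normalised generating functions of the admissible
configurations on the levels `≥ K`. -/
def LevelRecurrence (x y Q : R) (h : ℕ → R) : Prop :=
  ∀ K, h K = (1 - x * Q ^ K) * (1 - y * Q ^ K * Q ^ K) * h (K + 1) +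
    x * Q ^ K * (1 - y * Q ^ K) * (1 - Q ^ (K + 1)) *
      (h (K + 1) + (1 - x * Q ^ (K + 1)) * (y * Q ^ (K + 1)) * Q ^ (K + 1) * h (K + 2))

/-- Contiguity: a solution of the recurrence for `y` gives a solution for `y * Q ^ 2`. -/
theorem LevelRecurrence.shift {x y Q : R} {h g : ℕ → R} (hh : LevelRecurrence x y Q h)
    (hu : ∀ j, IsUnit (1 - y * Q ^ j))
    (hg : ∀ K, (1 - y * Q ^ K) * g K =
      h K - y * Q ^ K * (1 - Q ^ K) * (1 - x * Q ^ K) * h (K + 1)) :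
    LevelRecurrence x (y * Q ^ 2) Q g := by
  intro K
  refine ((hu K).mul ((hu (K + 1)).mul (hu (K + 2)))).mul_left_cancel ?_
  have e0 := hg K
  have e1 := hg (K + 1)
  have e2 := hg (K + 2)
  have r0 := hh K
  have r1 := hh (K + 1)
  simp only [add_assoc, Nat.reduceAdd] at e0 e1 e2 r0 r1 ⊢
  simp only [pow_add, pow_one] at e0 e1 e2 r0 r1 ⊢
  generalize h K = h0 at *
  generalize h (K + 1) = h1 at *
  generalize h (K + 2) = h2 at *
  generalize h (K + 3) = h3 at *
  generalize g K = g0 at *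
  generalize g (K + 1) = g1 at *
  generalize g (K + 2) = g2 at *
  generalize Q ^ K = a at *
  -- Express each `g` through `h` and remove `h0` by `r0`. What remains in `h1, h2, h3` is a
  -- multiple of `r1`; the multiplier is the coefficient of `h1`.
  linear_combination (1 - y * (a * Q)) * (1 - y * (a * Q ^ 2)) * (e0 + r0) -
    (1 - y * a) * (1 - y * (a * Q ^ 2)) *
      ((1 - x * a) * (1 - y * Q ^ 2 * a * a) + x * a * (1 - y * Q ^ 2 * a) * (1 - a * Q)) * e1 -
    (1 - y * a) * (1 - y * (a * Q)) * (x * a * (1 - y * Q ^ 2 * a) * (1 - a * Q) *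
      ((1 - x * (a * Q)) * (y * Q ^ 2 * (a * Q)) * (a * Q))) * e2 +
    ((1 - y * (a * Q)) * (1 - y * (a * Q ^ 2)) * ((1 - x * a) * (1 - y * a * a) +
        x * a * (1 - y * a) * (1 - a * Q) - y * a * (1 - a) * (1 - x * a)) -
      (1 - y * a) * (1 - y * (a * Q ^ 2)) *
      ((1 - x * a) * (1 - y * Q ^ 2 * a * a) + x * a * (1 - y * Q ^ 2 * a) * (1 - a * Q))) * r1

/-- Each shift `y ↦ y Q^2` extracts one factor `1 - y`; after `m` shifts `y = 0` and the recurrence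
telescopes. -/
theorem LevelRecurrence.eval_zero {x Q : R} {N : ℕ} (hQ : Q ^ N = 0) (m : ℕ) :
    ∀ (y : R) (h : ℕ → R), LevelRecurrence x y Q h → (∀ K, N ≤ K → h K = 1) →
      y * Q ^ (2 * m) = 0 → (∀ j, IsUnit (1 - y * Q ^ j)) →
      h 0 = (∏ k ∈ Finset.range m, (1 - y * Q ^ (2 * k))) *
        ∏ k ∈ Finset.range N, (1 - x * Q ^ (2 * k + 1)) := by
  have hQ' : ∀ K, N ≤ K → Q ^ K = 0 := fun K hK => pow_eq_zero_of_le hK hQ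
  induction m with
  | zero =>
    intro y h hh h1 hy _
    obtain rfl : y = 0 := by simpa using hy
    have step : ∀ K, h K = (1 - x * Q ^ (2 * K + 1)) * h (K + 1) := by
      intro K
      have := hh K
      simp only [pow_add, pow_one, pow_mul'] at this ⊢
      linear_combination this
    have key : ∀ M, h 0 = (∏ k ∈ Finset.range M, (1 - x * Q ^ (2 * k + 1))) * h M := by
      intro M
      induction M with
      | zero => simp
      | succ M ih => rw [Finset.prod_range_succ, ih, step M]; ring
    simpa [h1 N le_rfl] using key N
  | succ m ih =>
    intro y h hh h1 hy hu
    choose u hu' using fun j => (hu j).exists_right_inv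
    have hg : ∀ K, (1 - y * Q ^ K) *
        (u K * (h K - y * Q ^ K * (1 - Q ^ K) * (1 - x * Q ^ K) * h (K + 1))) =
        h K - y * Q ^ K * (1 - Q ^ K) * (1 - x * Q ^ K) * h (K + 1) := fun K => by
      rw [← mul_assoc, hu', one_mul]
    have := ih (y * Q ^ 2) _ (hh.shift hu hg) (fun K hK => ?_) ?_ fun j => ?_
    -- At level 0 the correction term carries `1 - Q ^ 0 = 0`, so `h 0 = (1 - y) * g 0`.
    · have h0 := hg 0
      simp only [pow_zero, mul_one, sub_self, mul_zero, zero_mul, sub_zero] at h0 this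
      rw [← h0, this, Finset.prod_range_succ']
      simp only [mul_add, pow_add, mul_one, mul_zero, pow_zero]
      simp only [mul_left_comm, mul_assoc, mul_comm]
    · have := hu' K
      simp only [hQ' K hK, mul_zero, sub_zero, one_mul, zero_mul] at this ⊢
      rw [this, h1 K hK, mul_one]
    · rw [mul_assoc, ← pow_add, ← hy]; ring
    · rw [mul_assoc, ← pow_add]; exact hu _

theorem prod_range_two_mul {M : Type*} [CommMonoid M] (f : ℕ → M) (n : ℕ) :
    ∏ k ∈ Finset.range (2 * n), f k =
      (∏ k ∈ Finset.range n, f (2 * k)) * ∏ k ∈ Finset.range n, f (2 * k + 1) := by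
  induction n with
  | zero => simp
  | succ n ih =>
    rw [show 2 * (n + 1) = 2 * n + 1 + 1 by ring, Finset.prod_range_succ, Finset.prod_range_succ,
      ih, Finset.prod_range_succ, Finset.prod_range_succ]
    simp only [mul_assoc, mul_left_comm]

end Recurrence

/-! ### Weighted sums over admissible supports, by levels of three. -/

section SupportSums

/-- The supports of the partitions that satisfy the difference conditions (apart from the
exclusion of `2`). -/
def AdmissibleSupport (S : Finset ℕ) : Prop :=
  ∀ i ∈ S, (i % 3 = 0 → i + 2 ∉ S) ∧ (i % 3 = 1 → i + 1 ∉ S ∧ i + 2 ∉ S)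

/-- An element below all of `S` is never `i + 1` or `i + 2` for `i ∈ S`, so only its own condition
is new. -/
theorem admissibleSupport_insert {a : ℕ} {S : Finset ℕ} (h : ∀ j ∈ S, a < j) :
    AdmissibleSupport (insert a S) ↔ AdmissibleSupport S ∧ (a % 3 = 0 → a + 2 ∉ S) ∧
      (a % 3 = 1 → a + 1 ∉ S ∧ a + 2 ∉ S) := by
  unfold AdmissibleSupport
  simp only [Finset.mem_insert]
  constructor
  · intro H
    refine ⟨fun i hi => ?_, ?_⟩
    · have := H i (Or.inr hi); tauto
    · have := H a (Or.inl rfl); tauto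
  · rintro ⟨H, H'⟩ i (rfl | hi)
    · constructor
      · intro h0; have := H'.1 h0; rintro (h | h) <;> first | omega | tauto
      · intro h0; have := H'.2 h0
        constructor <;> rintro (h | h) <;> first | omega | tauto
    · have h1 := H i hi
      have h2 := h i hi
      constructor
      · intro h0; have := h1.1 h0; rintro (h | h) <;> first | omega | tauto
      · intro h0; have := h1.2 h0
        constructor <;> rintro (h | h) <;> first | omega | tauto

variable {R : Type*} [CommRing R]

open Classical in
/-- The sum of `∏ i ∈ S, T i` over the subsets `S` of `s` that satisfy `φ`. -/
noncomputable def supportSum (T : ℕ → R) (s : Finset ℕ) (φ : Finset ℕ → Prop) : R :=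
  ∑ S ∈ s.powerset, if φ S then ∏ i ∈ S, T i else 0

theorem supportSum_congr (T : ℕ → R) {s : Finset ℕ} {φ ψ : Finset ℕ → Prop}
    (h : ∀ S ⊆ s, (φ S ↔ ψ S)) : supportSum T s φ = supportSum T s ψ := by
  classical
  refine Finset.sum_congr rfl fun S hS => ?_
  simp only [h S (Finset.mem_powerset.mp hS)]

theorem supportSum_insert (T : ℕ → R) {s : Finset ℕ} {a : ℕ} (ha : a ∉ s)
    (φ : Finset ℕ → Prop) :
    supportSum T (insert a s) φ =
      supportSum T s φ + T a * supportSum T s (fun S => φ (insert a S)) := by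
  classical
  unfold supportSum
  rw [Finset.sum_powerset_insert ha, Finset.mul_sum]
  congr 1
  refine Finset.sum_congr rfl fun S hS => ?_
  rw [Finset.prod_insert fun h => ha (Finset.mem_powerset.mp hS h), mul_ite, mul_zero]

theorem supportSum_false (T : ℕ → R) (s : Finset ℕ) : supportSum T s (fun _ => False) = 0 := by
  simp [supportSum]

/-- The weighted number of admissible supports in `[3 * K, M)`. -/
noncomputable def admissibleSum (T : ℕ → R) (M K : ℕ) : R :=
  supportSum T (Finset.Ico (3 * K) M) AdmissibleSupport

/-- The weighted number of admissible supports in `[3 * K, M)` that avoid `3 * K`. -/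
noncomputable def admissibleSumAvoiding (T : ℕ → R) (M K : ℕ) : R :=
  supportSum T (Finset.Ico (3 * K) M) fun S => AdmissibleSupport S ∧ 3 * K ∉ S

theorem Ico_eq_insert_insert_insert {a M : ℕ} (h : a + 3 ≤ M) :
    Finset.Ico a M = insert a (insert (a + 1) (insert (a + 2) (Finset.Ico (a + 3) M))) := by
  ext i
  simp only [Finset.mem_insert, Finset.mem_Ico]
  omega

theorem supportSum_Ico (T : ℕ → R) {a M : ℕ} (h : a + 3 ≤ M) (φ : Finset ℕ → Prop) :
    supportSum T (Finset.Ico a M) φ =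
      supportSum T (Finset.Ico (a + 3) M) φ +
      T (a + 2) * supportSum T (Finset.Ico (a + 3) M) (fun S => φ (insert (a + 2) S)) +
      T (a + 1) * (supportSum T (Finset.Ico (a + 3) M) (fun S => φ (insert (a + 1) S)) +
        T (a + 2) * supportSum T (Finset.Ico (a + 3) M)
          (fun S => φ (insert (a + 1) (insert (a + 2) S)))) +
      T a * (supportSum T (Finset.Ico (a + 3) M) (fun S => φ (insert a S)) +
        T (a + 2) * supportSum T (Finset.Ico (a + 3) M)
          (fun S => φ (insert a (insert (a + 2) S))) +
        T (a + 1) * (supportSum T (Finset.Ico (a + 3) M)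
            (fun S => φ (insert a (insert (a + 1) S))) +
          T (a + 2) * supportSum T (Finset.Ico (a + 3) M)
            (fun S => φ (insert a (insert (a + 1) (insert (a + 2) S)))))) := by
  have h2 : a + 2 ∉ Finset.Ico (a + 3) M := by simp
  have h1 : a + 1 ∉ insert (a + 2) (Finset.Ico (a + 3) M) := by simp
  have h0 : a ∉ insert (a + 1) (insert (a + 2) (Finset.Ico (a + 3) M)) := by simp
  rw [Ico_eq_insert_insert_insert h]
  simp only [supportSum_insert T h0, supportSum_insert T h1, supportSum_insert T h2]

section Level

variable {K M : ℕ} {S : Finset ℕ}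

theorem lt_of_mem_level (hS : S ⊆ Finset.Ico (3 * K + 3) M) {i : ℕ}
    (hi : i < 3 * K + 3) : ∀ j ∈ S, i < j := fun j hj => by
  have := Finset.mem_Ico.mp (hS hj)
  omega

theorem notMem_level (hS : S ⊆ Finset.Ico (3 * K + 3) M) {i : ℕ}
    (hi : i < 3 * K + 3) : i ∉ S := fun h =>
  lt_irrefl i (lt_of_mem_level hS hi i h)

theorem admissible_insert_two (hS : S ⊆ Finset.Ico (3 * K + 3) M) :
    AdmissibleSupport (insert (3 * K + 2) S) ↔ AdmissibleSupport S := by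
  rw [admissibleSupport_insert (lt_of_mem_level hS (by omega))]
  have h1 : (3 * K + 2) % 3 = 2 := by omega
  simp [h1]

theorem admissible_insert_one (hS : S ⊆ Finset.Ico (3 * K + 3) M) :
    AdmissibleSupport (insert (3 * K + 1) S) ↔
    AdmissibleSupport S ∧ 3 * K + 3 ∉ S := by
  rw [admissibleSupport_insert (lt_of_mem_level hS (by omega))]
  have h1 : (3 * K + 1) % 3 = 1 := by omega
  simp [h1, add_assoc, notMem_level hS]

theorem admissible_insert_zero (hS : S ⊆ Finset.Ico (3 * K + 3) M) :
    AdmissibleSupport (insert (3 * K) S) ↔ AdmissibleSupport S := by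
  rw [admissibleSupport_insert (lt_of_mem_level hS (by omega))]
  simp [notMem_level hS]

theorem admissible_insert_zero_one (hS : S ⊆ Finset.Ico (3 * K + 3) M) :
    AdmissibleSupport (insert (3 * K) (insert (3 * K + 1) S)) ↔
    AdmissibleSupport S ∧ 3 * K + 3 ∉ S := by
  rw [admissibleSupport_insert (by simpa using lt_of_mem_level hS (by omega)),
    admissible_insert_one hS]
  simp [notMem_level hS]

theorem not_admissible_insert_one_two :
    ¬ AdmissibleSupport (insert (3 * K + 1) (insert (3 * K + 2) S)) := fun h =>
  ((h (3 * K + 1) (by simp)).2 (by omega)).1 (by simp)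

theorem not_admissible_insert_zero_two :
    ¬ AdmissibleSupport (insert (3 * K) (insert (3 * K + 2) S)) := fun h =>
  (h (3 * K) (by simp)).1 (by omega) (by simp)

theorem not_admissible_insert_zero_one_two :
    ¬ AdmissibleSupport (insert (3 * K) (insert (3 * K + 1) (insert (3 * K + 2) S))) := fun h =>
  (h (3 * K) (by simp)).1 (by omega) (by simp)

end Level

/-- A level may hold `∅`, `{3K}`, `{3K+1}`, `{3K+2}` or `{3K, 3K+1}`. Only `3K+1` constrains the
next level: it forbids `3K+3`. -/
theorem admissibleSum_step (T : ℕ → R) {M K : ℕ} (h : 3 * K + 3 ≤ M) :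
    admissibleSum T M K =
      (1 + T (3 * K) + T (3 * K + 2)) * admissibleSum T M (K + 1) +
      (1 + T (3 * K)) * T (3 * K + 1) * admissibleSumAvoiding T M (K + 1) := by
  unfold admissibleSum admissibleSumAvoiding
  rw [supportSum_Ico T h, mul_add 3 K 1, mul_one,
    supportSum_congr T fun S hS => admissible_insert_two hS,
    supportSum_congr T fun S hS => admissible_insert_one hS,
    supportSum_congr T fun S hS => admissible_insert_zero hS,
    supportSum_congr T fun S hS => admissible_insert_zero_one hS]
  simp only [not_admissible_insert_one_two, not_admissible_insert_zero_two,
    not_admissible_insert_zero_one_two, supportSum_false]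
  ring

theorem admissibleSumAvoiding_step (T : ℕ → R) {M K : ℕ} (h : 3 * K + 3 ≤ M) :
    admissibleSumAvoiding T M K =
      (1 + T (3 * K + 2)) * admissibleSum T M (K + 1) +
      T (3 * K + 1) * admissibleSumAvoiding T M (K + 1) := by
  unfold admissibleSum admissibleSumAvoiding
  have hK : ∀ S ⊆ Finset.Ico (3 * K + 3) M, 3 * K ∉ S := fun S hS => notMem_level hS (by omega)
  rw [supportSum_Ico T h, mul_add 3 K 1, mul_one]
  simp only [not_admissible_insert_one_two, false_and, supportSum_false, Finset.mem_insert,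
    true_or, not_true_eq_false, and_false]
  rw [supportSum_congr T (φ := fun S => AdmissibleSupport S ∧ 3 * K ∉ S) (ψ := AdmissibleSupport)
      fun S hS => by simp [hK S hS],
    supportSum_congr T (φ := fun S => AdmissibleSupport (insert (3 * K + 2) S) ∧ _)
      (ψ := AdmissibleSupport) fun S hS => by simp [hK S hS, admissible_insert_two hS],
    supportSum_congr T (φ := fun S => AdmissibleSupport (insert (3 * K + 1) S) ∧ _)
      (ψ := fun S => AdmissibleSupport S ∧ 3 * K + 3 ∉ S) fun S hS => by
        simp [hK S hS, admissible_insert_one hS]]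
  ring

theorem supportSum_no_two (T : ℕ → R) {M : ℕ} (h : 3 ≤ M) :
    supportSum T (Finset.Ico 1 M) (fun S => AdmissibleSupport S ∧ 2 ∉ S) =
      admissibleSum T M 1 + T 1 * admissibleSumAvoiding T M 1 := by
  have e : Finset.Ico 1 M = insert 1 (insert 2 (Finset.Ico 3 M)) := by
    ext i
    simp only [Finset.mem_insert, Finset.mem_Ico]
    omega
  have h2 : ∀ S ⊆ Finset.Ico (3 * 0 + 3) M, 2 ∉ S := fun S hS => notMem_level hS (by omega)
  rw [e, supportSum_insert T (by simp), supportSum_insert T (by simp),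
    supportSum_insert T (by simp)]
  unfold admissibleSum admissibleSumAvoiding
  simp only [Finset.mem_insert, true_or, or_true, not_true_eq_false, and_false, supportSum_false]
  rw [supportSum_congr T (φ := fun S => AdmissibleSupport S ∧ 2 ∉ S) (ψ := AdmissibleSupport)
      fun S hS => by simp [h2 S hS],
    supportSum_congr T (φ := fun S => AdmissibleSupport (insert 1 S) ∧ _)
      (ψ := fun S => AdmissibleSupport S ∧ 3 ∉ S) fun S hS => by
        simpa [h2 S hS] using admissible_insert_one (K := 0) hS]
  simp

theorem admissibleSum_of_le (T : ℕ → R) {N K : ℕ} (h : N ≤ K) : admissibleSum T (3 * N) K = 1 := by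
  rw [admissibleSum, Finset.Ico_eq_empty (by omega)]
  simp [supportSum, AdmissibleSupport]

theorem admissibleSumAvoiding_of_le (T : ℕ → R) {N K : ℕ} (h : N ≤ K) :
    admissibleSumAvoiding T (3 * N) K = 1 := by
  rw [admissibleSumAvoiding, Finset.Ico_eq_empty (by omega)]
  simp [supportSum, AdmissibleSupport]

/-- The product formula for the weighted number of admissible supports. -/
theorem supportSum_admissible_mul {x y Q : R} {N L : ℕ} (hN : 0 < N) (hQ : Q ^ N = 0)
    (hy : y * Q ^ (2 * L) = 0) (hu : ∀ j, IsUnit (1 - y * Q ^ j)) (T : ℕ → R)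
    (h0 : ∀ k, 0 < k → T (3 * k) * (1 - Q ^ k) = Q ^ k)
    (h1 : ∀ k, T (3 * k + 1) * (1 - x * Q ^ k) = x * Q ^ k)
    (h2 : ∀ k, T (3 * k + 2) * (1 - y * Q ^ k) = y * Q ^ k) :
    supportSum T (Finset.Ico 1 (3 * N)) (fun S => AdmissibleSupport S ∧ 2 ∉ S) *
        ((1 - x) * (1 - y) *
          ∏ k ∈ Finset.Ico 1 N, (1 - Q ^ k) * (1 - x * Q ^ k) * (1 - y * Q ^ k)) =
      (∏ k ∈ Finset.range L, (1 - y * Q ^ (2 * k))) *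
        ∏ k ∈ Finset.range N, (1 - x * Q ^ (2 * k + 1)) := by
  set D : ℕ → R := fun K => ∏ k ∈ Finset.Ico K N, (1 - Q ^ k) * (1 - x * Q ^ k) * (1 - y * Q ^ k)
    with hD
  have hQ' : ∀ K, N ≤ K → Q ^ K = 0 := fun K hK => pow_eq_zero_of_le hK hQ
  have hDs : ∀ K < N, D K = (1 - Q ^ K) * (1 - x * Q ^ K) * (1 - y * Q ^ K) * D (K + 1) :=
    fun K hK => Finset.prod_eq_prod_Ico_succ_bot hK _
  have hD1 : ∀ K, N ≤ K → D K = 1 := fun K hK => by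
    simp only [hD, Finset.Ico_eq_empty_of_le hK, Finset.prod_empty]
  set P := fun K => admissibleSum T (3 * N) K * D K with hP
  set V := fun K => admissibleSumAvoiding T (3 * N) K * D K with hV
  have hP1 : ∀ K, N ≤ K → P K = 1 := fun K hK => by
    simp only [hP, admissibleSum_of_le T hK, hD1 K hK, one_mul]
  have hV1 : ∀ K, N ≤ K → V K = 1 := fun K hK => by
    simp only [hV, admissibleSumAvoiding_of_le T hK, hD1 K hK, one_mul]
  have stepP : ∀ K, 0 < K → P K = (1 - x * Q ^ K) * (1 - y * Q ^ K * Q ^ K) * P (K + 1) +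
      x * Q ^ K * (1 - y * Q ^ K) * V (K + 1) := by
    intro K hK
    rcases lt_or_ge K N with hKN | hKN
    · simp only [hP, hV]
      rw [hDs K hKN, admissibleSum_step T (by omega)]
      have e0 := h0 K hK
      have e1 := h1 K
      have e2 := h2 K
      generalize Q ^ K = e at *
      generalize D (K + 1) = d
      generalize admissibleSum T (3 * N) (K + 1) = p
      generalize admissibleSumAvoiding T (3 * N) (K + 1) = v
      linear_combination ((1 - x * e) * (1 - y * e) * e0 + (1 - e) * (1 - x * e) * e2) * p * d +
        ((1 - x * e) * (1 - y * e) * T (3 * K + 1) * e0 + (1 - y * e) * e1) * v * d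
    · rw [hP1 K hKN, hP1 (K + 1) (by omega), hV1 (K + 1) (by omega), hQ' K hKN]; ring
  have stepV : ∀ K, 0 < K → V K = (1 - Q ^ K) * ((1 - x * Q ^ K) * P (K + 1) +
      x * Q ^ K * (1 - y * Q ^ K) * V (K + 1)) := by
    intro K hK
    rcases lt_or_ge K N with hKN | hKN
    · simp only [hP, hV]
      rw [hDs K hKN, admissibleSumAvoiding_step T (by omega)]
      have e1 := h1 K
      have e2 := h2 K
      generalize Q ^ K = e at *
      generalize D (K + 1) = d
      generalize admissibleSum T (3 * N) (K + 1) = p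
      generalize admissibleSumAvoiding T (3 * N) (K + 1) = v
      linear_combination ((1 - e) * (1 - x * e) * e2) * p * d +
        ((1 - e) * (1 - y * e) * e1) * v * d
    · rw [hV1 K hKN, hP1 (K + 1) (by omega), hV1 (K + 1) (by omega), hQ' K hKN]; ring
  -- The two steps carry `V (K + 1)` with coefficients in ratio `1 - Q ^ K`, so it can be
  -- eliminated.
  have hVP : ∀ K, 0 < K →
      V K = (1 - Q ^ K) * (P K + (1 - x * Q ^ K) * (y * Q ^ K) * Q ^ K * P (K + 1)) := by
    intro K hK
    linear_combination stepV K hK - (1 - Q ^ K) * stepP K hK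
  -- `P 0` is unusable: `T 0` is unconstrained and its denominator `1 - Q ^ 0` vanishes. The sum
  -- without the part 2 replaces it and fits the recurrence at `K = 0`, as if 0 were always in the
  -- support and thereby excluded 2.
  let h : ℕ → R := fun K =>
    if K = 0 then supportSum T (Finset.Ico 1 (3 * N)) (fun S => AdmissibleSupport S ∧ 2 ∉ S) *
        ((1 - x) * (1 - y) * D 1) else P K
  have hs : ∀ K, h (K + 1) = P (K + 1) := fun K => if_neg K.succ_ne_zero
  have hz : h 0 = (admissibleSum T (3 * N) 1 + T 1 * admissibleSumAvoiding T (3 * N) 1) *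
      ((1 - x) * (1 - y) * D 1) := by
    rw [← supportSum_no_two T (show 3 ≤ 3 * N by omega)]
    exact if_pos rfl
  have hrec : LevelRecurrence x y Q h := by
    rintro (_ | K)
    · have e1 := h1 0
      have e := hVP 1 one_pos
      have eP : P 1 = admissibleSum T (3 * N) 1 * D 1 := rfl
      have eV : V 1 = admissibleSumAvoiding T (3 * N) 1 * D 1 := rfl
      rw [hz, hs 0, hs (0 + 1)]
      simp only [mul_zero, zero_add, pow_zero, pow_one, mul_one] at e1 e ⊢
      linear_combination (1 - y) * admissibleSumAvoiding T (3 * N) 1 * D 1 * e1 -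
        (1 - x) * (1 - y) * eP - x * (1 - y) * eV + x * (1 - y) * e
    · rw [hs K, hs (K + 1), hs (K + 2), stepP (K + 1) (by omega), hVP (K + 1 + 1) (by omega)]
      ring
  exact hrec.eval_zero hQ L y h (fun K hK => by
    simp only [h, if_neg (show K ≠ 0 by omega), hP1 K hK]) hy hu

end SupportSums

/-! ### From support sums to generating functions of partitions. -/

section PartitionSeries

variable {A : Type*} [CommRing A]

/-- The generating function `∑_{j ≥ 1} a ^ j X ^ (i * j)` of the nonempty multisets of copies of a
part `i` of weight `a`. -/
noncomputable def partSeries (a : A) (i : ℕ) : PowerSeries A :=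
  PowerSeries.mk fun d => if i ∣ d ∧ d ≠ 0 then a ^ (d / i) else 0

theorem partSeries_mul (a : A) {i : ℕ} (hi : 0 < i) :
    partSeries a i * (1 - PowerSeries.C a * PowerSeries.X ^ i) =
      PowerSeries.C a * PowerSeries.X ^ i := by
  rw [mul_sub, mul_one, sub_eq_iff_eq_add]
  ext d
  rw [mul_left_comm, map_add, PowerSeries.coeff_C_mul, PowerSeries.coeff_C_mul,
    PowerSeries.coeff_X_pow, PowerSeries.coeff_mul_X_pow', partSeries, PowerSeries.coeff_mk,
    PowerSeries.coeff_mk]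
  rcases lt_trichotomy d i with h | rfl | h
  · have : ¬ (i ∣ d ∧ d ≠ 0) := fun h' => h'.2 (Nat.eq_zero_of_dvd_of_lt h'.1 h)
    simp [this, h.not_ge, h.ne]
  · simp [hi.ne', Nat.div_self hi]
  · obtain ⟨e, rfl⟩ := Nat.exists_eq_add_of_lt h
    have h1 : i ∣ i + e + 1 ↔ i ∣ e + 1 := by
      rw [add_assoc, Nat.dvd_add_right (dvd_refl i)]
    have h2 : i + e + 1 - i = e + 1 := by omega
    have h3 : (i + e + 1) / i = (e + 1) / i + 1 := by
      rw [add_assoc, Nat.add_div_left _ hi]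
    have h4 : i ≤ i + e + 1 := by omega
    have h5 : i + e + 1 ≠ i := by omega
    rw [if_pos h4, if_neg h5, h2, h3]
    simp [h1, pow_succ']

/-- The product of the part series over `S` enumerates the partitions whose set of parts is `S`. -/
theorem coeff_prod_partSeries (w : ℕ → A) {S : Finset ℕ} (hS : 0 ∉ S) (n : ℕ) :
    PowerSeries.coeff n (∏ i ∈ S, partSeries (w i) i) =
      ∑ p : n.Partition with p.parts.toFinset = S, (p.parts.map w).prod := by
  rw [PowerSeries.coeff_prod]
  symm
  refine Finset.sum_of_injOn Nat.Partition.toFinsuppAntidiag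
    (Nat.Partition.toFinsuppAntidiag_injective n).injOn ?_ ?_ ?_
  · intro p hp
    have hp : p.parts.toFinset = S := by simpa using hp
    have := p.toFinsuppAntidiag_mem_finsuppAntidiag
    simp only [SetLike.mem_coe, Finset.mem_finsuppAntidiag'] at this ⊢
    exact ⟨this.1, hp.le⟩
  · intro g hg hg'
    by_contra hne
    refine hg' ?_
    have hne : ∀ i ∈ S, i ∣ g i ∧ g i ≠ 0 := fun i hi => by
      by_contra hc
      exact hne (Finset.prod_eq_zero hi (by simp [partSeries, hc]))
    obtain ⟨hsum, hsupp⟩ := Finset.mem_finsuppAntidiag.mp hg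
    have hgS : ∀ i, g i ≠ 0 ↔ i ∈ S := fun i =>
      ⟨fun h => hsupp (Finsupp.mem_support_iff.mpr h), fun h => (hne i h).2⟩
    have hc : ∀ i, g i / i * i = g i := fun i => by
      by_cases hi : i ∈ S
      · exact Nat.div_mul_cancel (hne i hi).1
      · rw [not_ne_iff.mp (mt (hgS i).mp hi)]; simp
    let m : ℕ →₀ ℕ := Finsupp.mk S (fun i => g i / i) fun i => by
      rw [← hgS, not_iff_not]
      constructor
      · intro h; rw [h]; simp
      · intro h; rw [← hc, h, zero_mul]
    have hm : ∀ i, i ∈ Finsupp.toMultiset m ↔ i ∈ S := fun i => by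
      rw [Finsupp.mem_toMultiset]
    refine ⟨⟨Finsupp.toMultiset m, fun {i} hi => ?_, ?_⟩, ?_, ?_⟩
    · exact Nat.pos_of_ne_zero fun h => hS (h ▸ (hm i).mp hi)
    · rw [Finsupp.sum_toMultiset, ← hsum]
      exact Finset.sum_congr rfl fun i _ => by simpa [m] using hc i
    · simp only [Finset.coe_filter, Finset.mem_univ, true_and, Set.mem_ofPred_eq]
      ext i
      rw [Multiset.mem_toFinset, hm]
    · ext i
      simpa [Nat.Partition.toFinsuppAntidiag, m] using hc i
  · intro p hp
    obtain rfl : p.parts.toFinset = S := by simpa using hp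
    rw [Finset.prod_multiset_map_count]
    refine Finset.prod_congr rfl fun i hi => ?_
    have hi' := Multiset.mem_toFinset.mp hi
    have h0 : 0 < i := p.parts_pos hi'
    have h1 : p.parts.count i ≠ 0 := (Multiset.count_pos.mpr hi').ne'
    simp [partSeries, Nat.Partition.toFinsuppAntidiag, h0.ne', hi', Nat.mul_div_cancel _ h0]

open Classical in
theorem coeff_supportSum (w : ℕ → A) {n M : ℕ} (hM : n < M) (φ : Finset ℕ → Prop) :
    PowerSeries.coeff n (supportSum (fun i => partSeries (w i) i) (Finset.Ico 1 M) φ) =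
      ∑ p : n.Partition with φ p.parts.toFinset, (p.parts.map w).prod := by
  have h0 : ∀ S ∈ (Finset.Ico 1 M).powerset, 0 ∉ S := fun S hS h => by
    simpa using Finset.mem_powerset.mp hS h
  have hp : ∀ p : n.Partition, p.parts.toFinset ∈ (Finset.Ico 1 M).powerset := fun p => by
    refine Finset.mem_powerset.mpr fun i hi => Finset.mem_Ico.mpr ?_
    have hi' := Multiset.mem_toFinset.mp hi
    have h1 := p.parts_pos hi'
    have h2 := Nat.Partition.le_of_mem_parts hi'
    omega
  rw [supportSum, map_sum, Finset.sum_filter,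
    ← Finset.sum_fiberwise_of_maps_to (t := (Finset.Ico 1 M).powerset)
      (g := fun p : n.Partition => p.parts.toFinset) fun p _ => hp p]
  refine Finset.sum_congr rfl fun S hS => ?_
  rw [apply_ite (PowerSeries.coeff n), coeff_prod_partSeries w (h0 S hS), map_zero]
  split_ifs with h
  · refine Finset.sum_congr rfl fun p hp => ?_
    rw [if_pos ((Finset.mem_filter.mp hp).2 ▸ h)]
  · refine (Finset.sum_eq_zero fun p hp => ?_).symm
    rw [if_neg ((Finset.mem_filter.mp hp).2 ▸ h)]

/-- The weight of a part, for partitions counted by the numbers of their parts congruent to `i`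
and to `j` modulo `m`. -/
def residueWeight (x y : A) (i j m a : ℕ) : A :=
  if a ≡ i [MOD m] then x else if a ≡ j [MOD m] then y else 1

theorem prod_map_residueWeight (x y : A) (i j m : ℕ) (hij : ¬ i ≡ j [MOD m]) (s : Multiset ℕ) :
    (s.map (residueWeight x y i j m)).prod =
      x ^ s.countP (· ≡ i [MOD m]) * y ^ s.countP (· ≡ j [MOD m]) := by
  induction s using Multiset.induction_on with
  | empty => simp
  | cons a s ih =>
    rw [Multiset.map_cons, Multiset.prod_cons, ih, Multiset.countP_cons, Multiset.countP_cons,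
      residueWeight]
    by_cases h1 : a ≡ i [MOD m]
    · have h2 : ¬ a ≡ j [MOD m] := fun h2 => hij (h1.symm.trans h2)
      simp only [h1, h2, if_true, if_false]; ring
    · by_cases h2 : a ≡ j [MOD m] <;> simp only [h1, h2, if_true, if_false] <;> ring

theorem map_supportSum {B : Type*} [CommRing B] (f : A →+* B) (T : ℕ → A) (s : Finset ℕ)
    (φ : Finset ℕ → Prop) : f (supportSum T s φ) = supportSum (fun i => f (T i)) s φ := by
  classical
  simp only [supportSum, map_sum, apply_ite f, map_prod, map_zero]

theorem supportSum_forall (T : ℕ → A) (s : Finset ℕ) (c : ℕ → Prop) [DecidablePred c] :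
    supportSum T s (fun S => ∀ i ∈ S, c i) = ∏ i ∈ s, (1 + if c i then T i else 0) := by
  classical
  rw [Finset.prod_one_add, supportSum]
  refine Finset.sum_congr rfl fun S _ => ?_
  rw [Finset.prod_ite_zero]
  congr

theorem prod_range_six_mul {M : Type*} [CommMonoid M] {u z a b : ℕ → M}
    (h0 : ∀ k, u (6 * k) * z (2 * k) = 1) (h1 : ∀ k, u (6 * k + 1) * a k = 1)
    (h2 : ∀ k, u (6 * k + 2) = 1) (h3 : ∀ k, u (6 * k + 3) * z (2 * k + 1) = 1)
    (h4 : ∀ k, u (6 * k + 4) = 1) (h5 : ∀ k, u (6 * k + 5) * b k = 1) (N : ℕ) :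
    (∏ i ∈ Finset.range (6 * N), u i) * ((∏ k ∈ Finset.range (2 * N), z k) *
      (∏ k ∈ Finset.range N, a k) * ∏ k ∈ Finset.range N, b k) = 1 := by
  induction N with
  | zero => simp
  | succ N ih =>
    have e6 : 6 * (N + 1) = 6 * N + 5 + 1 := by ring
    have e2 : 2 * (N + 1) = 2 * N + 1 + 1 := by ring
    rw [e6, e2]
    simp only [Finset.prod_range_succ, h2, h4, mul_one]
    calc _ = ((∏ i ∈ Finset.range (6 * N), u i) * ((∏ k ∈ Finset.range (2 * N), z k) *
          (∏ k ∈ Finset.range N, a k) * ∏ k ∈ Finset.range N, b k)) *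
          (u (6 * N) * z (2 * N)) * (u (6 * N + 1) * a N) * (u (6 * N + 3) * z (2 * N + 1)) *
          (u (6 * N + 5) * b N) := by
            simp only [mul_assoc, mul_left_comm, mul_comm]
      _ = 1 := by rw [ih, h0, h1, h3, h5]; simp

end PartitionSeries

/-! ### Adjacent parts and the reduction to supports. -/

section Adjacency

/-- Drop entries until the last copy of `a` is at the head; the next entry is then below `a`, at
least `b`, and hence `b`. -/
theorem pair_isInfix_of_pairwise_ge {a b : ℕ} (hab : b < a) :
    ∀ {l : List ℕ}, l.Pairwise (· ≥ ·) → a ∈ l → b ∈ l → (∀ c ∈ l, ¬ (b < c ∧ c < a)) →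
      [a, b] <:+: l
  | [], _, ha, _, _ => by simp at ha
  | c :: l, hl, ha, hb, hc => by
    have hl' := List.pairwise_cons.mp hl
    by_cases hal : a ∈ l
    · have hbl : b ∈ l := by
        rcases List.mem_cons.mp hb with rfl | h
        · exact absurd (hl'.1 a hal) (by omega)
        · exact h
      exact (pair_isInfix_of_pairwise_ge hab hl'.2 hal hbl
        fun d hd => hc d (List.mem_cons_of_mem _ hd)).trans (List.suffix_cons c l).isInfix
    · obtain rfl : a = c := (List.mem_cons.mp ha).resolve_right hal
      have hbl : b ∈ l := (List.mem_cons.mp hb).resolve_left hab.ne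
      cases l with
      | nil => simp at hbl
      | cons d l =>
        have h1 : a ≥ d := hl'.1 d (by simp)
        have h2 : a ≠ d := fun h => hal (by simp [h])
        have h3 : d ≥ b := by
          rcases List.mem_cons.mp hbl with rfl | h
          · exact le_rfl
          · exact (List.pairwise_cons.mp hl'.2).1 b h
        have h4 := hc d (by simp)
        obtain rfl : d = b := by omega
        exact (List.prefix_append [a, d] l).isInfix

variable {n : ℕ} {p : n.Partition}

theorem AdjacentParts.mem {a b : ℕ} (h : AdjacentParts p a b) : a ∈ p.parts ∧ b ∈ p.parts := by
  have := h.subset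
  simp only [List.cons_subset, Multiset.mem_sort] at this
  exact ⟨this.1, this.2.1⟩

theorem adjacentParts_of_forall {a b : ℕ} (hab : b < a) (ha : a ∈ p.parts) (hb : b ∈ p.parts)
    (h : ∀ c ∈ p.parts, ¬ (b < c ∧ c < a)) : AdjacentParts p a b :=
  pair_isInfix_of_pairwise_ge hab (Multiset.pairwise_sort _ _) (by simpa using ha)
    (by simpa using hb) (by simpa using h)

/-- Repetitions only create differences 0. If `i` and `i + 2` are parts with `3 ∣ i`, then either `i
+ 1` is absent and they are adjacent, or `i + 1`, `i + 2` violate the first condition. -/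
theorem differenceConditions_iff : DifferenceConditions p ↔
    AdmissibleSupport p.parts.toFinset ∧ 2 ∉ p.parts.toFinset := by
  simp only [AdmissibleSupport, Multiset.mem_toFinset]
  constructor
  · intro h
    have one : ∀ i ∈ p.parts, i % 3 = 1 → i + 1 ∉ p.parts := fun i hi h3 hi1 =>
      h.diff_one _ _ (adjacentParts_of_forall (by omega) hi1 hi fun c _ => by omega) rfl h3
    have two : ∀ i ∈ p.parts, i % 3 ≠ 2 → i + 1 ∉ p.parts → i + 2 ∉ p.parts :=
      fun i hi h3 hi1 hi2 => h3 (h.diff_two _ _ (adjacentParts_of_forall (by omega) hi2 hi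
        fun c hc hlt => hi1 (by rwa [show i + 1 = c by omega])) rfl)
    refine ⟨fun i hi => ⟨fun h3 hi2 => ?_, fun h3 => ⟨one i hi h3, two i hi (by omega)
      (one i hi h3)⟩⟩, h.no_two⟩
    by_cases hi1 : i + 1 ∈ p.parts
    · exact one (i + 1) hi1 (by omega) hi2
    · exact two i hi (by omega) hi1 hi2
  · rintro ⟨h, h2⟩
    refine ⟨fun a b hab e h3 => ?_, fun a b hab e => ?_, h2⟩
    · subst e
      exact ((h b hab.mem.2).2 h3).1 hab.mem.1
    · subst e
      change b % 3 = 2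
      have h0 := (h b hab.mem.2).1
      have h1 := (h b hab.mem.2).2
      have := Nat.mod_lt b (show 3 > 0 by norm_num)
      interval_cases hb : b % 3
      · exact absurd hab.mem.1 (h0 rfl)
      · exact absurd hab.mem.1 (h1 rfl).2
      · rfl

end Adjacency

/-! ### Comparison of the two generating functions. -/

section Main

-- In `ℤ[X][Y]` the inner variable marks residue `i` and the outer one residue `j`, so one
-- coefficient fixes both counts.
open Classical in
theorem card_eq_coeff (i j m : ℕ) (hij : ¬ i ≡ j [MOD m]) (m₁ m₂ n : ℕ) {M : ℕ} (hM : n < M)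
    (φ : Finset ℕ → Prop) (ψ : n.Partition → Prop) (h : ∀ p, ψ p ↔ φ p.parts.toFinset) :
    (Nat.card {p : n.Partition // ψ p ∧ numPartsModEq p i m = m₁ ∧ numPartsModEq p j m = m₂} : ℤ) =
      ((PowerSeries.coeff n (supportSum (fun a => partSeries
        (residueWeight (Polynomial.C Polynomial.X) (Polynomial.X : Polynomial (Polynomial ℤ))
          i j m a) a) (Finset.Ico 1 M) φ)).coeff m₂).coeff m₁ := by
  rw [coeff_supportSum _ hM, Polynomial.finsetSum_coeff, Polynomial.finsetSum_coeff,
    Nat.card_eq_fintype_card, Fintype.card_subtype, Finset.card_filter, Finset.sum_filter]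
  push_cast
  refine Finset.sum_congr rfl fun p _ => ?_
  simp only [h]
  rw [prod_map_residueWeight _ _ _ _ _ hij, ← map_pow, Polynomial.coeff_C_mul_X_pow, ← numPartsModEq,
    ← numPartsModEq]
  by_cases h1 : φ p.parts.toFinset <;> by_cases h2 : numPartsModEq p i m = m₁ <;>
    by_cases h3 : numPartsModEq p j m = m₂ <;>
    simp [h1, h2, h3, Polynomial.coeff_X_pow, eq_comm (a := m₁), eq_comm (a := m₂)]

/-- The two weighted sums over supports agree in a ring where `q` is nilpotent. -/
theorem supportSum_eq_of_nilpotent {R : Type*} [CommRing R] {x y q : R} {N : ℕ} (hN : 0 < N)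
    (hq : q ^ N = 0) {T U : ℕ → R}
    (hT : ∀ i, 0 < i → T i * (1 - residueWeight x y 1 2 3 i * q ^ i) =
      residueWeight x y 1 2 3 i * q ^ i)
    (hU : ∀ i, 0 < i → U i * (1 - residueWeight x y 1 5 6 i * q ^ i) =
      residueWeight x y 1 5 6 i * q ^ i) :
    supportSum U (Finset.Ico 1 (6 * N)) (fun S => ∀ i ∈ S,
        i ≡ 0 [MOD 6] ∨ i ≡ 1 [MOD 6] ∨ i ≡ 3 [MOD 6] ∨ i ≡ 5 [MOD 6]) =
      supportSum T (Finset.Ico 1 (6 * N)) (fun S => AdmissibleSupport S ∧ 2 ∉ S) := by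
  set X := x * q with hX
  set Y := y * q ^ 2 with hY
  set Q := q ^ 3 with hQ
  have unit : ∀ (c : R) (k : ℕ), 0 < k → IsUnit (1 - c * q ^ k) := fun c k hk =>
    IsNilpotent.isUnit_one_sub ((Commute.all _ _).isNilpotent_mul_left
      ((IsNilpotent.pow_iff_pos hk.ne').mpr ⟨N, hq⟩))
  have hQN : ∀ k, N ≤ k → Q ^ k = 0 := fun k hk => by
    rw [hQ, ← pow_mul]; exact pow_eq_zero_of_le (by omega) hq
  have hQk : ∀ k, Q ^ k = q ^ (3 * k) := fun k => (pow_mul q 3 k).symm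
  have hXk : ∀ k, X * Q ^ k = x * q ^ (3 * k + 1) := fun k => by rw [hQk, hX]; ring
  have hYk : ∀ k, Y * Q ^ k = y * q ^ (3 * k + 2) := fun k => by rw [hQk, hY]; ring
  have hYu : ∀ k, IsUnit (1 - Y * Q ^ k) := fun k => by rw [hYk]; exact unit _ _ (by omega)
  have hXu : ∀ k, IsUnit (1 - X * Q ^ k) := fun k => by rw [hXk]; exact unit _ _ (by omega)
  have w0 : ∀ k, residueWeight x y 1 2 3 (3 * k) = 1 := fun k => by
    simp [residueWeight, Nat.ModEq]
  have w1 : ∀ k, residueWeight x y 1 2 3 (3 * k + 1) = x := fun k => by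
    simp [residueWeight, Nat.ModEq]
  have w2 : ∀ k, residueWeight x y 1 2 3 (3 * k + 2) = y := fun k => by
    simp [residueWeight, Nat.ModEq]
  -- `2 * N` levels of three make `N` full periods mod 6.
  have main := supportSum_admissible_mul (x := X) (y := Y) (Q := Q) (N := 2 * N) (L := N)
    (by omega) (hQN _ (by omega)) (by rw [hQN _ (by omega), mul_zero]) hYu T
    (fun k hk => by simpa [w0, hQk] using hT (3 * k) (by omega))
    (fun k => by simpa [w1, hXk] using hT (3 * k + 1) (by omega))
    (fun k => by simpa [w2, hYk] using hT (3 * k + 2) (by omega))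
  rw [show 3 * (2 * N) = 6 * N by ring] at main
  -- The value 1 at 0 omits the zero factor `1 - Q ^ 0`, as 0 is not a part.
  let z : ℕ → R := fun k => if k = 0 then 1 else 1 - Q ^ k
  have hD : (1 - X) * (1 - Y) * ∏ k ∈ Finset.Ico 1 (2 * N),
      (1 - Q ^ k) * (1 - X * Q ^ k) * (1 - Y * Q ^ k) =
      (∏ k ∈ Finset.range (2 * N), z k) * (∏ k ∈ Finset.range (2 * N), (1 - X * Q ^ k)) *
        ∏ k ∈ Finset.range (2 * N), (1 - Y * Q ^ k) := by
    simp only [Finset.range_eq_Ico, ← Finset.prod_mul_distrib]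
    rw [Finset.prod_eq_prod_Ico_succ_bot (a := 0) (by omega)]
    congr 1
    · simp [z]
    · refine Finset.prod_congr rfl fun k hk => ?_
      have : k ≠ 0 := by have := Finset.mem_Ico.mp hk; omega
      simp [z, this]
  have hodd : ∏ k ∈ Finset.range (2 * N), (1 - X * Q ^ (2 * k + 1)) =
      ∏ k ∈ Finset.range N, (1 - X * Q ^ (2 * k + 1)) := by
    refine (Finset.prod_subset (Finset.range_mono (by omega)) fun k _ hk => ?_).symm
    rw [hQN _ (by simp at hk; omega), mul_zero, sub_zero]
  rw [hD, hodd, prod_range_two_mul (fun k => 1 - X * Q ^ k),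
    prod_range_two_mul (fun k => 1 - Y * Q ^ k)] at main
  -- The denominators left after the odd `X` factors and the even `Y` factors cancel, all of them
  -- units.
  set Z := (∏ k ∈ Finset.range (2 * N), z k) * (∏ k ∈ Finset.range N, (1 - X * Q ^ (2 * k))) *
    ∏ k ∈ Finset.range N, (1 - Y * Q ^ (2 * k + 1)) with hZ
  have prodUnit : ∀ (f : ℕ → R), (∀ k, IsUnit (f k)) → IsUnit (∏ k ∈ Finset.range N, f k) :=
    fun f hf => (IsUnit.prod_iff).mpr fun k _ => hf k
  have hTZ : supportSum T (Finset.Ico 1 (6 * N)) (fun S => AdmissibleSupport S ∧ 2 ∉ S) * Z = 1 := by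
    refine ((prodUnit (fun k => 1 - Y * Q ^ (2 * k)) fun k => hYu _).mul
      (prodUnit (fun k => 1 - X * Q ^ (2 * k + 1)) fun k => hXu _)).mul_right_cancel ?_
    refine Eq.trans ?_ (main.trans (one_mul _).symm)
    ring
  have hUZ : supportSum U (Finset.Ico 1 (6 * N)) (fun S => ∀ i ∈ S,
      i ≡ 0 [MOD 6] ∨ i ≡ 1 [MOD 6] ∨ i ≡ 3 [MOD 6] ∨ i ≡ 5 [MOD 6]) * Z = 1 := by
    let u : ℕ → R := fun i => if i = 0 then 1 else
      1 + if i ≡ 0 [MOD 6] ∨ i ≡ 1 [MOD 6] ∨ i ≡ 3 [MOD 6] ∨ i ≡ 5 [MOD 6] then U i else 0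
    have hu : supportSum U (Finset.Ico 1 (6 * N)) (fun S => ∀ i ∈ S,
        i ≡ 0 [MOD 6] ∨ i ≡ 1 [MOD 6] ∨ i ≡ 3 [MOD 6] ∨ i ≡ 5 [MOD 6]) =
        ∏ i ∈ Finset.range (6 * N), u i := by
      rw [supportSum_forall, Finset.range_eq_Ico,
        Finset.prod_eq_prod_Ico_succ_bot (a := 0) (by omega)]
      simp only [u, if_true, one_mul]
      refine Finset.prod_congr rfl fun k hk => ?_
      have hk0 : k ≠ 0 := by have := Finset.mem_Ico.mp hk; omega
      simp only [if_neg hk0]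
    rw [hu, hZ]
    refine prod_range_six_mul (u := u) (fun k => ?_) (fun k => ?_) (fun k => ?_) (fun k => ?_)
      (fun k => ?_) (fun k => ?_) N
    · rcases Nat.eq_zero_or_pos k with rfl | hk
      · simp [u, z]
      · have := hU (6 * k) (by omega)
        simp [residueWeight, Nat.ModEq] at this
        simp [u, z, hk.ne', Nat.ModEq, hQk, ← mul_assoc]
        linear_combination this
    · have := hU (6 * k + 1) (by omega)
      simp [residueWeight, Nat.ModEq] at this
      simp [u, Nat.ModEq, hXk, ← mul_assoc]
      linear_combination this
    · simp [u, Nat.ModEq]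
    · have := hU (6 * k + 3) (by omega)
      simp [residueWeight, Nat.ModEq] at this
      simp [u, z, Nat.ModEq, hQk, mul_add, ← mul_assoc]
      linear_combination this
    · simp [u, Nat.ModEq]
    · have := hU (6 * k + 5) (by omega)
      simp [residueWeight, Nat.ModEq] at this
      simp [u, Nat.ModEq, hYk, mul_add, add_assoc, ← mul_assoc]
      linear_combination this
  have hZu : IsUnit Z := IsUnit.of_mul_eq_one _ ((mul_comm _ _).trans hTZ)
  exact hZu.mul_right_cancel (hUZ.trans hTZ.symm)

/-- The quotient by `X ^ (n + 1)` makes `X` nilpotent and still determines the coefficient of degree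
`n`. -/
theorem coeff_supportSum_eq {A : Type*} [CommRing A] (x y : A) (n : ℕ) :
    PowerSeries.coeff n (supportSum (fun a => partSeries (residueWeight x y 1 5 6 a) a)
        (Finset.Ico 1 (6 * (n + 1))) (fun S => ∀ i ∈ S,
          i ≡ 0 [MOD 6] ∨ i ≡ 1 [MOD 6] ∨ i ≡ 3 [MOD 6] ∨ i ≡ 5 [MOD 6])) =
      PowerSeries.coeff n (supportSum (fun a => partSeries (residueWeight x y 1 2 3 a) a)
        (Finset.Ico 1 (6 * (n + 1))) (fun S => AdmissibleSupport S ∧ 2 ∉ S)) := by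
  let I : Ideal (PowerSeries A) := Ideal.span {PowerSeries.X ^ (n + 1)}
  let f := Ideal.Quotient.mk I
  have hX : f PowerSeries.X ^ (n + 1) = 0 := by
    rw [← map_pow]
    exact Ideal.Quotient.eq_zero_iff_mem.mpr (Ideal.mem_span_singleton_self _)
  have hw : ∀ i j m a, f (PowerSeries.C (residueWeight x y i j m a)) =
      residueWeight (f (PowerSeries.C x)) (f (PowerSeries.C y)) i j m a := fun i j m a => by
    simp only [residueWeight]
    split_ifs <;> simp
  have hs : ∀ i j m a, 0 < a → f (partSeries (residueWeight x y i j m a) a) *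
      (1 - residueWeight (f (PowerSeries.C x)) (f (PowerSeries.C y)) i j m a *
        f PowerSeries.X ^ a) =
      residueWeight (f (PowerSeries.C x)) (f (PowerSeries.C y)) i j m a * f PowerSeries.X ^ a :=
    fun i j m a ha => by
      simpa [hw] using congrArg f (partSeries_mul (residueWeight x y i j m a) ha)
  have key := supportSum_eq_of_nilpotent n.succ_pos hX (hs 1 2 3) (hs 1 5 6)
  rw [← map_supportSum, ← map_supportSum, Ideal.Quotient.eq, Ideal.mem_span_singleton,
    PowerSeries.X_pow_dvd_iff] at key
  have := key n (by omega)
  rwa [map_sub, sub_eq_zero] at this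

end Main

theorem mainTheorem4 (m₁ m₂ n : ℕ) : C₁ m₁ m₂ n = C₂ m₁ m₂ n := by
  have h1 := card_eq_coeff 1 5 6 (by decide) m₁ m₂ n (M := 6 * (n + 1)) (by omega)
    (fun S => ∀ i ∈ S, i ≡ 0 [MOD 6] ∨ i ≡ 1 [MOD 6] ∨ i ≡ 3 [MOD 6] ∨ i ≡ 5 [MOD 6])
    (fun p => ∀ x ∈ p.parts, x ≡ 0 [MOD 6] ∨ x ≡ 1 [MOD 6] ∨ x ≡ 3 [MOD 6] ∨ x ≡ 5 [MOD 6])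
    (fun p => by simp only [Multiset.mem_toFinset])
  have h2 := card_eq_coeff 1 2 3 (by decide) m₁ m₂ n (M := 6 * (n + 1)) (by omega)
    (fun S => AdmissibleSupport S ∧ 2 ∉ S) DifferenceConditions
    (fun p => differenceConditions_iff)
  rw [coeff_supportSum_eq, ← h2] at h1
  exact_mod_cast h1
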